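/- For integers $n\ge 1$ let $$d_n=\sum_{k=2}^n \binom{n}{k}(-1)^k\frac{1}{\zeta(k)}$$ be the differences of inverse zeta values, where $\zeta$ is the Riemann zeta function (the sum is empty, so $d_1=0$, for $n=1$). The following two assertions are equivalent. (FVBD hypothesis) For every $\epsilon>0$ there exists a constant $C_\epsilon>0$ such that $|d_n|<C_\epsilon\, n^{1/2+\epsilon}$ for all integers $n\ge 1$. (Riemann hypothesis) The (meromorphically continued) Riemann zeta function $\zeta(s)$ has no zeros in the half-plane $\Re(s)>\frac12$. -/

import Mathlib

/-- The differences of inverse zeta values,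
`d_n = ∑_{k=2}^n (n choose k) (-1)^k / ζ(k)` (an empty sum for `n < 2`). -/
noncomputable def invZetaDiff (n : ℕ) : ℂ :=
  ∑ k ∈ Finset.Icc 2 n, (n.choose k : ℂ) * (-1) ^ k * (1 / riemannZeta (k : ℂ))

/-- The growth hypothesis on the differences of inverse zeta values: for every `ε > 0` there is
a constant `C > 0` with `|d_n| < C n^(1/2 + ε)` for all `n ≥ 1`. -/
def FVBDHypothesis : Prop :=
  ∀ ε : ℝ, 0 < ε → ∃ C : ℝ, 0 < C ∧
    ∀ n : ℕ, 1 ≤ n → ‖invZetaDiff n‖ < C * (n : ℝ) ^ ((1 / 2 : ℝ) + ε)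

/-- The Riemann hypothesis, as absence of zeros of the Riemann zeta function in the half-plane
`Re s > 1/2`. The pole `s = 1` is excluded explicitly. -/
def ZetaZeroFreeHalfPlane : Prop :=
  ∀ s : ℂ, (1 / 2 : ℝ) < s.re → s ≠ 1 → riemannZeta s ≠ 0

/-! Inserting `1/ζ(k) = ∑ μ(m) m^(-k)` and the binomial theorem gives `d_n = ∑ μ(m) ((1 - 1/m)^n - 1
+ n/m)`. Replacing `(1 - 1/m)^n` by `exp (-n/m)` costs only `O(n^(1/2))`
(`exists_norm_invZetaDiff_sub_le`), and passing from integers to real `x` costs `O(x^(1/2))`. So the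
growth hypothesis amounts to `F(x) = O(x^(1/2 + ε))` for `F = moebiusExpSum`.

For `1 < Re s < 2` the Mellin transform of `F` at `-s` is `Γ(-s)/ζ(s) = Γ(2 - s) / (s (s - 1) ζ(s))`
(`mellin_moebiusExpSum`). If `F` has the stated growth, the transform is holomorphic on `1/2 < Re s
< 2`. The identity persists there, and a zero of `ζ` would force the nonvanishing `Γ(2 - s)` to
vanish.

Conversely, without zeros in `Re s > 1/2`, Borel–Carathéodory bounds `1/((s - 1) ζ(s))` polynomially
in `Im s` on `1/2 + ε ≤ Re s ≤ 2`. The rapid decay of `Γ` absorbs this, so in the Mellin inversion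
formula for `F` the line `Re s = 3/2` can be moved to `Re s = 1/2 + ε`, which gives `F(x) = O(x^(1/2
+ ε))`. -/

open Filter Topology Asymptotics MeasureTheory Set
open scoped ArithmeticFunction.Moebius

/-! ### The smoothed Möbius sum: size and regularity -/

/-- The remainder `exp (-u) - 1 + u` of the exponential series after its linear term. -/
noncomputable def expRem (u : ℝ) : ℝ := Real.exp (-u) - 1 + u

/-- The Möbius sum `∑ μ(m) (exp (-x/m) - 1 + x/m)`. -/
noncomputable def moebiusExpSum (x : ℝ) : ℂ := ∑' m : ℕ, (μ m : ℂ) * (expRem (x / m) : ℂ)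

lemma expRem_zero : expRem 0 = 0 := by simp [expRem]

lemma expRem_nonneg (u : ℝ) : 0 ≤ expRem u := by
  have := Real.add_one_le_exp (-u)
  unfold expRem; linarith

lemma continuous_expRem : Continuous expRem := by
  unfold expRem; fun_prop

lemma expRem_le_self {u : ℝ} (hu : 0 ≤ u) : expRem u ≤ u := by
  have : Real.exp (-u) ≤ 1 := Real.exp_le_one_iff.2 (by linarith)
  unfold expRem; linarith

lemma expRem_le_sq {u : ℝ} (hu : 0 ≤ u) : expRem u ≤ u ^ 2 := by
  rcases le_total u 1 with h | h
  · have := Real.abs_exp_sub_one_sub_id_le (x := -u) (by rwa [abs_neg, abs_of_nonneg hu])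
    have := (abs_le.1 this).2
    unfold expRem; nlinarith
  · have := expRem_le_self hu
    nlinarith

/-- Interpolates between the quadratic bound, sharper for `u ≤ 1`, and the linear one, sharper for
`u ≥ 1`. Any exponent above `1` makes the sum over `m` converge. -/
lemma expRem_le_rpow {u a : ℝ} (hu : 0 ≤ u) (h1 : 1 ≤ a) (h2 : a ≤ 2) : expRem u ≤ u ^ a := by
  rcases hu.eq_or_lt with rfl | hu0
  · rw [expRem_zero]; positivity
  rcases le_total u 1 with h | h
  · calc expRem u ≤ u ^ (2 : ℝ) := by simpa using expRem_le_sq hu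
      _ ≤ u ^ a := Real.rpow_le_rpow_of_exponent_ge hu0 h h2
  · calc expRem u ≤ u ^ (1 : ℝ) := by simpa using expRem_le_self hu
      _ ≤ u ^ a := Real.rpow_le_rpow_of_exponent_le h h1

lemma norm_moebius_le (m : ℕ) : ‖(μ m : ℂ)‖ ≤ 1 := by
  rw [Complex.norm_intCast]
  exact_mod_cast ArithmeticFunction.abs_moebius_le_one

lemma norm_moebius_mul_le {m : ℕ} {z : ℂ} {B : ℝ} (h : ‖z‖ ≤ B) : ‖(μ m : ℂ) * z‖ ≤ B := by
  rw [norm_mul]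
  exact (mul_le_of_le_one_left (norm_nonneg _) (norm_moebius_le m)).trans h

lemma norm_expRem_div_le {x a : ℝ} (hx : 0 ≤ x) (h1 : 1 ≤ a) (h2 : a ≤ 2) (m : ℕ) :
    ‖(expRem (x / m) : ℂ)‖ ≤ x ^ a * (1 / (m : ℝ) ^ a) := by
  rw [Complex.norm_real, Real.norm_of_nonneg (expRem_nonneg _), mul_one_div,
    ← Real.div_rpow hx (Nat.cast_nonneg m)]
  exact expRem_le_rpow (by positivity) h1 h2

lemma summable_moebiusExpSum {x : ℝ} (hx : 0 ≤ x) :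
    Summable fun m : ℕ ↦ (μ m : ℂ) * (expRem (x / m) : ℂ) :=
  Summable.of_norm_bounded
    ((Real.summable_one_div_nat_rpow.2 (by norm_num : (1 : ℝ) < 2)).mul_left (x ^ (2 : ℝ)))
    fun m ↦ norm_moebius_mul_le (norm_expRem_div_le hx one_le_two le_rfl m)

lemma norm_moebiusExpSum_le {a : ℝ} (h1 : 1 < a) (h2 : a ≤ 2) {x : ℝ} (hx : 0 ≤ x) :
    ‖moebiusExpSum x‖ ≤ (∑' m : ℕ, 1 / (m : ℝ) ^ a) * x ^ a := by
  rw [mul_comm, ← tsum_mul_left]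
  exact tsum_of_norm_bounded ((Real.summable_one_div_nat_rpow.2 h1).mul_left (x ^ a)).hasSum
    fun m ↦ norm_moebius_mul_le (norm_expRem_div_le hx h1.le h2 m)

lemma continuousOn_moebiusExpSum : ContinuousOn moebiusExpSum (Ioi 0) := by
  intro x hx
  have hx : 0 < x := hx
  have h : ContinuousOn moebiusExpSum (Icc 0 (x + 1)) := by
    refine continuousOn_tsum (u := fun m : ℕ ↦ (x + 1) ^ (2 : ℝ) * (1 / (m : ℝ) ^ (2 : ℝ)))
      (fun m ↦ ?_)
      ((Real.summable_one_div_nat_rpow.2 (by norm_num : (1 : ℝ) < 2)).mul_left _) ?_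
    · have := continuous_expRem
      fun_prop
    · intro m y hy
      refine norm_moebius_mul_le ((norm_expRem_div_le hy.1 one_le_two le_rfl m).trans ?_)
      have := hy.1
      have := hy.2
      gcongr
  exact (h.continuousAt (Icc_mem_nhds hx (by linarith))).continuousWithinAt

/-- The derivative `1 - exp (-u)` is increasing and at most `min 1 u ≤ u^(1/2)`. The exponent `1/2`
is chosen so that increments of length at most `1/m` give the summable weight `m^(-3/2)`. -/
lemma abs_expRem_sub_le {a b : ℝ} (ha : 0 ≤ a) (hab : a ≤ b) :
    |expRem b - expRem a| ≤ (b - a) * b ^ (1 / 2 : ℝ) := by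
  have hb : 0 ≤ b := ha.trans hab
  have e1 : Real.exp (-a) = Real.exp (-b) * Real.exp (b - a) := by
    rw [← Real.exp_add]; congr 1; ring
  have e2 : Real.exp (-b) = Real.exp (-a) * Real.exp (a - b) := by
    rw [← Real.exp_add]; congr 1; ring
  have i1 := Real.add_one_le_exp (b - a)
  have i2 := Real.add_one_le_exp (a - b)
  have i3 := Real.add_one_le_exp (-b)
  have i4 : Real.exp (-a) ≤ 1 := Real.exp_le_one_iff.2 (by linarith)
  have p1 := Real.exp_pos (-a)
  have p2 := Real.exp_pos (-b)
  have hm : 1 - Real.exp (-b) ≤ b ^ (1 / 2 : ℝ) := by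
    rcases le_total b 1 with h | h
    · rcases hb.eq_or_lt with rfl | hb0
      · simp
      have := Real.rpow_le_rpow_of_exponent_ge hb0 h (by norm_num : (1 / 2 : ℝ) ≤ 1)
      rw [Real.rpow_one] at this
      linarith
    · have := Real.one_le_rpow h (by norm_num : (0 : ℝ) ≤ 1 / 2)
      linarith
  rw [abs_of_nonneg (by unfold expRem; nlinarith)]
  calc expRem b - expRem a ≤ (b - a) * (1 - Real.exp (-b)) := by unfold expRem; nlinarith
    _ ≤ _ := mul_le_mul_of_nonneg_left hm (by linarith)

lemma exists_norm_moebiusExpSum_sub_floor_le :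
    ∃ C : ℝ, 0 ≤ C ∧ ∀ x : ℝ, 0 ≤ x →
      ‖moebiusExpSum x - moebiusExpSum ⌊x⌋₊‖ ≤ C * x ^ (1 / 2 : ℝ) := by
  refine ⟨∑' m : ℕ, 1 / (m : ℝ) ^ (3 / 2 : ℝ), tsum_nonneg fun m ↦ by positivity,
    fun x hx ↦ ?_⟩
  unfold moebiusExpSum
  rw [← (summable_moebiusExpSum hx).tsum_sub (summable_moebiusExpSum (Nat.cast_nonneg _)),
    mul_comm, ← tsum_mul_left]
  refine tsum_of_norm_bounded ((Real.summable_one_div_nat_rpow.2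
    (by norm_num : (1 : ℝ) < 3 / 2)).mul_left (x ^ (1 / 2 : ℝ))).hasSum fun m ↦ ?_
  rw [← mul_sub]
  apply norm_moebius_mul_le
  rw [← Complex.ofReal_sub, Complex.norm_real, Real.norm_eq_abs]
  -- Division by zero yields `0`, and `expRem 0 = 0`, so the index `m = 0` is harmless.
  rcases m.eq_zero_or_pos with rfl | hm
  · simp [expRem_zero]
  have hm : (0 : ℝ) < m := by exact_mod_cast hm
  refine (abs_expRem_sub_le (by positivity)
    (div_le_div_of_nonneg_right (Nat.floor_le hx) hm.le)).trans ?_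
  have : x / m - ⌊x⌋₊ / m ≤ 1 / m := by
    rw [← sub_div]
    exact div_le_div_of_nonneg_right (by linarith [Nat.lt_floor_add_one x]) hm.le
  calc (x / m - ⌊x⌋₊ / m) * (x / m) ^ (1 / 2 : ℝ) ≤ 1 / m * (x / m) ^ (1 / 2 : ℝ) := by gcongr
    _ = _ := by
      rw [Real.div_rpow hx hm.le, show (3 / 2 : ℝ) = 1 + 1 / 2 by norm_num,
        Real.rpow_add hm, Real.rpow_one]
      field_simp

/-! ### Comparison of `d_n` with the smoothed sum -/

/-- With `a = exp (-1/m)` and `b = 1 - 1/m`, one has `|b^n - a^n| ≤ |b - a| n a^(n-1)`, where `|b -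
a| ≤ m^(-2)` and `a^(n-1)` is at most a constant times `(m/n)^(1/2)`. -/
lemma abs_exp_sub_pow_le {n m : ℕ} (hn : 1 ≤ n) (hm : 1 ≤ m) :
    |(1 - 1 / (m : ℝ)) ^ n - Real.exp (-(n / m))| ≤
      3 * (n : ℝ) ^ (1 / 2 : ℝ) * (1 / (m : ℝ) ^ (3 / 2 : ℝ)) := by
  have hn' : (1 : ℝ) ≤ n := by exact_mod_cast hn
  have hm' : (1 : ℝ) ≤ m := by exact_mod_cast hm
  set a := Real.exp (-(1 / (m : ℝ))) with ha
  set b := 1 - 1 / (m : ℝ) with hb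
  have hb0 : 0 ≤ b := by rw [hb, sub_nonneg]; exact div_le_one_of_le₀ hm' (by positivity)
  have hab : b ≤ a := by have := Real.add_one_le_exp (-(1 / (m : ℝ))); rw [ha, hb]; linarith
  have hpow : ∀ k : ℕ, a ^ k = Real.exp (-(k / m)) := fun k ↦ by
    rw [ha, ← Real.exp_nat_mul]; congr 1; ring
  have hdiff : |b - a| ≤ 1 / (m : ℝ) ^ 2 := by
    have := expRem_le_sq (u := 1 / (m : ℝ)) (by positivity)
    rw [abs_of_nonpos (by linarith), ← one_div_pow]
    refine le_trans (le_of_eq ?_) this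
    rw [expRem, ← ha, hb]; ring
  have hpred : a ^ (n - 1) ≤ 3 * ((m : ℝ) / n) ^ (1 / 2 : ℝ) := by
    have e : a ^ (n - 1) = Real.exp (1 / m) * Real.exp (-(n / m)) := by
      rw [hpow, ← Real.exp_add]; congr 1; push_cast [hn]; ring
    -- The factor `3 > e` pays for replacing `n - 1` by `n` in the exponent.
    have e1 : Real.exp (1 / m) ≤ 3 := by
      have : Real.exp (1 / m) ≤ Real.exp 1 :=
        Real.exp_le_exp.2 (div_le_one_of_le₀ hm' (by positivity))
      linarith [Real.exp_one_lt_d9]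
    -- This is `exp (-u) ≤ u^(-1/2)`, from `√u ≤ u + 1 ≤ exp u`.
    have e2 : Real.exp (-(n / m)) ≤ ((m : ℝ) / n) ^ (1 / 2 : ℝ) := by
      rw [Real.exp_neg, ← inv_div (n : ℝ), Real.inv_rpow (by positivity)]
      refine inv_anti₀ (by positivity) ?_
      have h1 := Real.add_one_le_exp ((n : ℝ) / m)
      have h0 : 0 ≤ (n : ℝ) / m := by positivity
      refine le_trans ?_ h1
      rw [← Real.sqrt_eq_rpow]
      nlinarith [Real.sq_sqrt h0, Real.sqrt_nonneg ((n : ℝ) / m),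
        sq_nonneg (Real.sqrt ((n : ℝ) / m) - 1)]
    rw [e]; gcongr
  rw [← hpow]
  refine (abs_pow_sub_pow_le b a n).trans ?_
  rw [abs_of_nonneg hb0, abs_of_nonneg (hb0.trans hab), max_eq_right hab]
  calc |b - a| * n * a ^ (n - 1)
      ≤ 1 / (m : ℝ) ^ 2 * n * (3 * ((m : ℝ) / n) ^ (1 / 2 : ℝ)) := by gcongr
    _ = _ := by
      rw [Real.div_rpow (by positivity) (by positivity),
        show (3 / 2 : ℝ) = 2 - 1 / 2 by norm_num, Real.rpow_sub (by positivity), Real.rpow_two]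
      have : (n : ℝ) = (n : ℝ) ^ (1 / 2 : ℝ) * (n : ℝ) ^ (1 / 2 : ℝ) := by
        rw [← Real.rpow_add (by positivity)]; norm_num
      field_simp
      nth_rewrite 1 [this]
      ring

lemma hasSum_term_moebius {s : ℂ} (hs : 1 < s.re) :
    HasSum (LSeries.term (fun n ↦ ((μ n : ℤ) : ℂ)) s) (1 / riemannZeta s) := by
  have h := (ArithmeticFunction.LSeriesSummable_moebius_iff.2 hs).LSeriesHasSum
  have e : LSeries (fun n ↦ ((μ n : ℤ) : ℂ)) s = 1 / riemannZeta s := by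
    rw [eq_div_iff (riemannZeta_ne_zero_of_one_lt_re hs), mul_comm,
      ← LSeries_one_eq_riemannZeta hs]
    exact LSeries_one_mul_Lseries_moebius hs
  rwa [LSeriesHasSum, e] at h

lemma hasSum_moebius_one_div_pow {k : ℕ} (hk : 2 ≤ k) :
    HasSum (fun m : ℕ ↦ (μ m : ℂ) * (1 / (m : ℂ)) ^ k) (1 / riemannZeta k) := by
  have hk1 : 1 < ((k : ℂ)).re := by simpa using (by exact_mod_cast hk : (1 : ℝ) < k)
  have h := hasSum_term_moebius hk1
  convert h using 2 with m
  rcases m.eq_zero_or_pos with rfl | hm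
  · simp
  · rw [LSeries.term_of_ne_zero hm.ne', Complex.cpow_natCast, one_div, inv_pow, div_eq_mul_inv]

lemma sum_choose_two_le {n : ℕ} (hn : 1 ≤ n) (y : ℂ) :
    ∑ k ∈ Finset.Icc 2 n, (n.choose k : ℂ) * (-1) ^ k * y ^ k = (1 - y) ^ n - 1 + n * y := by
  have h : (1 - y) ^ n = ∑ k ∈ Finset.range (n + 1), (n.choose k : ℂ) * (-1) ^ k * y ^ k := by
    rw [sub_eq_neg_add, add_pow]
    refine Finset.sum_congr rfl fun k _ ↦ ?_
    rw [neg_pow]; ring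
  have hI : Finset.range (n + 1) = insert 0 (insert 1 (Finset.Icc 2 n)) := by
    ext k; simp; omega
  rw [h, hI, Finset.sum_insert (by simp), Finset.sum_insert (by simp)]
  simp

lemma hasSum_invZetaDiff {n : ℕ} (hn : 1 ≤ n) :
    HasSum (fun m : ℕ ↦ (μ m : ℂ) * ((1 - 1 / (m : ℂ)) ^ n - 1 + n * (1 / (m : ℂ))))
      (invZetaDiff n) := by
  have h : HasSum (fun m : ℕ ↦ ∑ k ∈ Finset.Icc 2 n,
      (n.choose k : ℂ) * (-1) ^ k * ((μ m : ℂ) * (1 / (m : ℂ)) ^ k)) (invZetaDiff n) :=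
    hasSum_sum fun k hk ↦ (hasSum_moebius_one_div_pow (Finset.mem_Icc.1 hk).1).mul_left _
  convert h using 2 with m
  rw [← sum_choose_two_le hn, Finset.mul_sum]
  exact Finset.sum_congr rfl fun k _ ↦ by ring

lemma exists_norm_invZetaDiff_sub_le :
    ∃ C : ℝ, 0 ≤ C ∧ ∀ n : ℕ, 1 ≤ n →
      ‖invZetaDiff n - moebiusExpSum n‖ ≤ C * (n : ℝ) ^ (1 / 2 : ℝ) := by
  refine ⟨3 * ∑' m : ℕ, 1 / (m : ℝ) ^ (3 / 2 : ℝ),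
    mul_nonneg (by norm_num) (tsum_nonneg fun m ↦ by positivity), fun n hn ↦ ?_⟩
  have h := (hasSum_invZetaDiff hn).sub (summable_moebiusExpSum (Nat.cast_nonneg n)).hasSum
  rw [mul_right_comm, ← tsum_mul_left]
  change HasSum _ (_ - moebiusExpSum n) at h
  rw [← h.tsum_eq]
  refine tsum_of_norm_bounded ((Real.summable_one_div_nat_rpow.2
    (by norm_num : (1 : ℝ) < 3 / 2)).mul_left (3 * (n : ℝ) ^ (1 / 2 : ℝ))).hasSum fun m ↦ ?_
  rcases m.eq_zero_or_pos with rfl | hm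
  · simp
  rw [← mul_sub]
  apply norm_moebius_mul_le
  refine le_of_eq_of_le ?_ (abs_exp_sub_pow_le hn hm)
  rw [← Real.norm_eq_abs, ← Complex.norm_real]
  congr 1
  simp only [expRem]
  push_cast
  ring

/-! ### Mellin transforms -/

lemma norm_cpow_mul_isBigO {l : Filter ℝ} (hl : ∀ᶠ x in l, 0 < x) {g : ℝ → ℂ} {a : ℝ} {w : ℂ}
    (hg : g =O[l] fun x ↦ x ^ (-a)) :
    (fun x : ℝ ↦ (x : ℂ) ^ w * g x) =O[l] fun x ↦ x ^ (w.re - a) := by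
  have h1 : (fun x : ℝ ↦ (x : ℂ) ^ w) =O[l] fun x : ℝ ↦ x ^ w.re := by
    refine IsBigO.of_bound 1 ?_
    filter_upwards [hl] with x hx
    rw [Complex.norm_cpow_eq_rpow_re_of_pos hx, Real.norm_of_nonneg (by positivity), one_mul]
  refine (h1.mul hg).congr' EventuallyEq.rfl ?_
  filter_upwards [hl] with x hx
  rw [← Real.rpow_add hx, sub_eq_add_neg]

/-- Integration by parts for the Mellin transform. -/
lemma mellin_deriv_add_one {g g' : ℝ → ℂ} {a b : ℝ} {w : ℂ}
    (hd : ∀ x : ℝ, 0 < x → HasDerivAt g (g' x) x)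
    (htop : g =O[atTop] fun x : ℝ ↦ x ^ (-a)) (hwa : w.re < a)
    (hbot : g =O[𝓝[>] 0] fun x : ℝ ↦ x ^ (-b)) (hwb : b < w.re)
    (hg' : MellinConvergent g' (w + 1)) :
    mellin g' (w + 1) = -w * mellin g w := by
  have hloc : LocallyIntegrableOn g (Ioi 0) :=
    ContinuousOn.locallyIntegrableOn
      (fun x hx ↦ (hd x hx).continuousAt.continuousWithinAt) measurableSet_Ioi
  have hg : MellinConvergent g w := mellinConvergent_of_isBigO_rpow hloc htop hwa hbot hwb
  have t0 : Tendsto ((fun x : ℝ ↦ (x : ℂ) ^ w) * g) (𝓝[>] 0) (𝓝 0) := by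
    refine (norm_cpow_mul_isBigO self_mem_nhdsWithin hbot).trans_tendsto ?_
    have : Tendsto (fun x : ℝ ↦ x ^ (w.re - b)) (𝓝 0) (𝓝 (0 ^ (w.re - b))) :=
      (Real.continuousAt_rpow_const 0 _ (Or.inr (by linarith))).tendsto
    rw [Real.zero_rpow (by linarith)] at this
    exact this.mono_left nhdsWithin_le_nhds
  have t1 : Tendsto ((fun x : ℝ ↦ (x : ℂ) ^ w) * g) atTop (𝓝 0) := by
    refine (norm_cpow_mul_isBigO (eventually_gt_atTop 0) htop).trans_tendsto ?_
    have := tendsto_rpow_neg_atTop (y := a - w.re) (by linarith)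
    simpa using this
  have hw0 (x : ℝ) (hx : x ∈ Ioi (0 : ℝ)) :
      HasDerivAt (fun x : ℝ ↦ (x : ℂ) ^ w) (w * (x : ℂ) ^ (w - 1)) x := by
    have h := (hasDerivAt_id (x : ℂ)).cpow_const (c := w) (Or.inl (by simpa using hx))
    simpa using h.comp_ofReal
  have h := integral_Ioi_mul_deriv_eq_deriv_mul hw0 hd
    (by simpa [MellinConvergent, Pi.mul_def] using hg')
    (by simpa [MellinConvergent, Pi.mul_def, mul_assoc, IntegrableOn] using hg.const_mul w) t0 t1
  simp only [mul_assoc, integral_const_mul] at h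
  simpa [mellin] using h

lemma isBigO_rpow_of_le {l : Filter ℝ} (hl : ∀ᶠ x in l, 0 < x) {g : ℝ → ℂ} {C a : ℝ}
    (h : ∀ x : ℝ, 0 < x → ‖g x‖ ≤ C * x ^ a) : g =O[l] fun x ↦ x ^ a := by
  refine IsBigO.of_bound C ?_
  filter_upwards [hl] with x hx
  rw [Real.norm_of_nonneg (by positivity)]
  exact h x hx

lemma norm_expRem_le_rpow {a : ℝ} (h1 : 1 ≤ a) (h2 : a ≤ 2) (x : ℝ) (hx : 0 < x) :
    ‖(expRem x : ℂ)‖ ≤ 1 * x ^ a := by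
  rw [Complex.norm_real, Real.norm_of_nonneg (expRem_nonneg _), one_mul]
  exact expRem_le_rpow hx.le h1 h2

lemma mellinConvergent_expRem {w : ℂ} (h1 : -2 < w.re) (h2 : w.re < -1) :
    MellinConvergent (fun x ↦ (expRem x : ℂ)) w := by
  have := continuous_expRem
  refine mellinConvergent_of_isBigO_rpow (a := -1) (b := -2)
    (Continuous.locallyIntegrable (by fun_prop) |>.locallyIntegrableOn _) ?_ h2 ?_ h1
  · exact isBigO_rpow_of_le (eventually_gt_atTop 0)
      (norm_expRem_le_rpow (by norm_num) (by norm_num))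
  · exact isBigO_rpow_of_le self_mem_nhdsWithin
      (norm_expRem_le_rpow (by norm_num) (by norm_num))

lemma norm_one_sub_exp_le_rpow {a : ℝ} (h1 : 0 ≤ a) (h2 : a ≤ 1) (x : ℝ) (hx : 0 < x) :
    ‖(1 - Complex.exp (-x))‖ ≤ 1 * x ^ a := by
  have e : (1 - Complex.exp (-x)) = ((1 - Real.exp (-x) : ℝ) : ℂ) := by push_cast; rfl
  have i1 : Real.exp (-x) ≤ 1 := Real.exp_le_one_iff.2 (by linarith)
  have i2 := Real.add_one_le_exp (-x)
  rw [e, Complex.norm_real, Real.norm_of_nonneg (by linarith), one_mul]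
  rcases le_total x 1 with h | h
  · have := Real.rpow_le_rpow_of_exponent_ge hx h h2
    rw [Real.rpow_one] at this
    linarith
  · have := Real.one_le_rpow h h1
    linarith [Real.exp_pos (-x)]

/-- Two integrations by parts lead through the derivatives `1 - exp (-x)` and `exp (-x)`, the last
having transform `Γ`. The strip reflects the size `x^2` at `0` and `x` at infinity. -/
lemma mellin_expRem {w : ℂ} (h1 : -2 < w.re) (h2 : w.re < -1) :
    mellin (fun x ↦ (expRem x : ℂ)) w * (w * (w + 1)) = Complex.Gamma (w + 2) := by
  have hG : 0 < (w + 1 + 1).re := by simp; linarith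
  have hA : mellin (fun x : ℝ ↦ Complex.exp (-x)) (w + 1 + 1) = Complex.Gamma (w + 1 + 1) := by
    rw [Complex.Gamma_eq_integral hG, Complex.GammaIntegral_eq_mellin]
    simp
  have hAc : MellinConvergent (fun x : ℝ ↦ Complex.exp (-x)) (w + 1 + 1) := by
    have := Complex.GammaIntegral_convergent hG
    simpa [MellinConvergent, mul_comm] using this
  have hB : mellin (fun x : ℝ ↦ Complex.exp (-x)) (w + 1 + 1) =
      -(w + 1) * mellin (fun x : ℝ ↦ 1 - Complex.exp (-x)) (w + 1) := by
    refine mellin_deriv_add_one (a := 0) (b := -1) (fun x _ ↦ ?_) ?_ (by simp; linarith) ?_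
      (by simp; linarith) hAc
    · have := ((hasDerivAt_id (x : ℂ)).neg.cexp.const_sub 1).comp_ofReal
      simpa using this
    · exact isBigO_rpow_of_le (eventually_gt_atTop 0)
        (norm_one_sub_exp_le_rpow (by norm_num) (by norm_num))
    · exact isBigO_rpow_of_le self_mem_nhdsWithin
        (norm_one_sub_exp_le_rpow (by norm_num) (by norm_num))
  have hBc : MellinConvergent (fun x : ℝ ↦ 1 - Complex.exp (-x)) (w + 1) := by
    refine mellinConvergent_of_isBigO_rpow (a := 0) (b := -1)
      (Continuous.locallyIntegrable (by fun_prop) |>.locallyIntegrableOn _) ?_ (by simp; linarith) ?_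
      (by simp; linarith)
    · exact isBigO_rpow_of_le (eventually_gt_atTop 0)
        (norm_one_sub_exp_le_rpow (by norm_num) (by norm_num))
    · exact isBigO_rpow_of_le self_mem_nhdsWithin
        (norm_one_sub_exp_le_rpow (by norm_num) (by norm_num))
  have hC : mellin (fun x : ℝ ↦ 1 - Complex.exp (-x)) (w + 1) =
      -w * mellin (fun x ↦ (expRem x : ℂ)) w := by
    refine mellin_deriv_add_one (a := -1) (b := -2) (fun x _ ↦ ?_) ?_ h2 ?_ h1 hBc
    · have := ((((hasDerivAt_id (x : ℂ)).neg.cexp).sub_const 1).add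
        (hasDerivAt_id (x : ℂ))).comp_ofReal
      convert this using 1
      · ext y; simp [expRem]
      · simp; ring
    · exact isBigO_rpow_of_le (eventually_gt_atTop 0)
        (norm_expRem_le_rpow (by norm_num) (by norm_num))
    · exact isBigO_rpow_of_le self_mem_nhdsWithin
        (norm_expRem_le_rpow (by norm_num) (by norm_num))
  rw [hA, hC] at hB
  rw [show w + 2 = w + 1 + 1 by ring, hB]
  ring

/-- Rescaling `x` to `x/m` multiplies the transform at `-s` by `m^(-s)`, so summing against `μ(m)`
produces `1/ζ(s)`. -/
lemma mellin_moebiusExpSum_eq_mul {s : ℂ} (h1 : 1 < s.re) (h2 : s.re < 2) :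
    mellin moebiusExpSum (-s) =
      1 / riemannZeta s * mellin (fun x ↦ (expRem x : ℂ)) (-s) := by
  set H : ℝ → ℂ := fun x ↦ (expRem x : ℂ)
  have hHc : MellinConvergent H (-s) :=
    mellinConvergent_expRem (by simp; linarith) (by simp; linarith)
  have hscale (m : ℕ) (hm : 0 < m) : (fun x : ℝ ↦ H (x / m)) = fun x ↦ H ((m : ℝ)⁻¹ * x) := by
    ext x; rw [div_eq_inv_mul]
  have hmpos (m : ℕ) (hm : 0 < m) : (0 : ℝ) < (m : ℝ)⁻¹ := by positivity
  have hconv (m : ℕ) : MellinConvergent (fun x ↦ H (x / m)) (-s) := by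
    rcases m.eq_zero_or_pos with rfl | hm
    · simp [MellinConvergent, H, expRem_zero]
    · rw [hscale m hm]
      exact (MellinConvergent.comp_mul_left (hmpos m hm)).2 hHc
  -- Scaling the absolute integrals gives `m^(-Re s)`, summable as `Re s > 1`; this justifies
  -- exchanging sum and integral.
  have hnorm (m : ℕ) : ∫ x in Ioi (0 : ℝ), ‖(x : ℂ) ^ (-s - 1) * ((μ m : ℂ) * H (x / m))‖ ≤
      1 / (m : ℝ) ^ s.re * ∫ x in Ioi (0 : ℝ), x ^ (-s.re - 1) * expRem x := by
    rcases m.eq_zero_or_pos with rfl | hm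
    · simp only [ArithmeticFunction.map_zero, Int.cast_zero, zero_mul, mul_zero, norm_zero,
        integral_zero]
      refine mul_nonneg (by positivity) (setIntegral_nonneg measurableSet_Ioi fun x hx ↦ ?_)
      exact mul_nonneg (Real.rpow_nonneg (le_of_lt hx) _) (expRem_nonneg x)
    have key : ∫ x in Ioi (0 : ℝ), x ^ (-s.re - 1) * expRem ((m : ℝ)⁻¹ * x) =
        1 / (m : ℝ) ^ s.re * ∫ x in Ioi (0 : ℝ), x ^ (-s.re - 1) * expRem x := by
      have hm' : (0 : ℝ) < m := by exact_mod_cast hm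
      have := integral_comp_mul_left_Ioi (fun x ↦ x ^ (-s.re - 1) * expRem x) 0 (hmpos m hm)
      rw [mul_zero, inv_inv, smul_eq_mul] at this
      have e : ∫ x in Ioi (0 : ℝ), ((m : ℝ)⁻¹ * x) ^ (-s.re - 1) * expRem ((m : ℝ)⁻¹ * x) =
          (m : ℝ) ^ (s.re + 1) * ∫ x in Ioi (0 : ℝ), x ^ (-s.re - 1) * expRem ((m : ℝ)⁻¹ * x) := by
        rw [← integral_const_mul]
        refine setIntegral_congr_fun measurableSet_Ioi fun x hx ↦ ?_
        rw [Real.mul_rpow (by positivity) (le_of_lt hx), Real.inv_rpow hm'.le,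
          ← Real.rpow_neg hm'.le, show -(-s.re - 1) = s.re + 1 by ring, mul_assoc]
      rw [e, Real.rpow_add hm', Real.rpow_one] at this
      have h0 : (m : ℝ) ^ s.re ≠ 0 := by positivity
      field_simp at this ⊢
      linarith
    rw [← key]
    have hint := hconv m
    simp only [MellinConvergent, div_eq_inv_mul] at hint
    have hint2 := hint.norm
    refine setIntegral_mono_on ?_ ?_ measurableSet_Ioi fun x hx ↦ ?_
    · have := (hint.const_mul (μ m : ℂ)).norm
      refine IntegrableOn.congr_fun this (fun x hx ↦ ?_) measurableSet_Ioi
      simp only [smul_eq_mul, div_eq_inv_mul]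
      congr 1; ring
    · refine IntegrableOn.congr_fun hint2 (fun x hx ↦ ?_) measurableSet_Ioi
      simp only [smul_eq_mul, norm_mul, H]
      rw [Complex.norm_cpow_eq_rpow_re_of_pos hx, Complex.norm_real,
        Real.norm_of_nonneg (expRem_nonneg _)]
      simp
    · rw [norm_mul, Complex.norm_cpow_eq_rpow_re_of_pos hx]
      simp only [Complex.sub_re, Complex.neg_re, Complex.one_re]
      have hx' : (0 : ℝ) < x := hx
      refine mul_le_mul_of_nonneg_left (norm_moebius_mul_le ?_) (by positivity)
      rw [Complex.norm_real, Real.norm_of_nonneg (expRem_nonneg _), div_eq_inv_mul]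
  have hS : HasSum (fun m : ℕ ↦ ∫ x in Ioi (0 : ℝ), (x : ℂ) ^ (-s - 1) * ((μ m : ℂ) * H (x / m)))
      (∫ x in Ioi (0 : ℝ), ∑' m : ℕ, (x : ℂ) ^ (-s - 1) * ((μ m : ℂ) * H (x / m))) :=
    hasSum_integral_of_summable_integral_norm
    (F := fun (m : ℕ) (x : ℝ) ↦ (x : ℂ) ^ (-s - 1) * ((μ m : ℂ) * H (x / m)))
    (fun m ↦ by
      refine IntegrableOn.congr_fun ((hconv m).const_mul (μ m : ℂ)) (fun x hx ↦ ?_)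
        measurableSet_Ioi
      simp only [smul_eq_mul]; ring)
    (Summable.of_nonneg_of_le (fun m ↦ integral_nonneg fun x ↦ norm_nonneg _) hnorm
      ((Real.summable_one_div_nat_rpow.2 h1).mul_right _))
  have hL : (∫ x in Ioi (0 : ℝ), ∑' m : ℕ, (x : ℂ) ^ (-s - 1) * ((μ m : ℂ) * H (x / m))) =
      mellin moebiusExpSum (-s) := by
    simp_rw [tsum_mul_left]
    rfl
  rw [hL] at hS
  have hz : HasSum (fun m : ℕ ↦ LSeries.term (fun n ↦ ((μ n : ℤ) : ℂ)) s m * mellin H (-s))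
      (1 / riemannZeta s * mellin H (-s)) := (hasSum_term_moebius h1).mul_right _
  refine hS.unique ?_
  convert hz using 2 with m
  rcases m.eq_zero_or_pos with rfl | hm
  · simp
  have e : ∀ x : ℝ, (x : ℂ) ^ (-s - 1) * ((μ m : ℂ) * H (x / m)) =
      (μ m : ℂ) * ((x : ℂ) ^ (-s - 1) • H ((m : ℝ)⁻¹ * x)) := fun x ↦ by
    rw [smul_eq_mul, div_eq_inv_mul]; ring
  simp_rw [e]
  rw [integral_const_mul]
  change _ * mellin (fun x : ℝ ↦ H ((m : ℝ)⁻¹ * x)) (-s) = _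
  rw [mellin_comp_mul_left _ _ (hmpos m hm), LSeries.term_of_ne_zero hm.ne', neg_neg, smul_eq_mul,
    ← mul_assoc]
  congr 1
  rw [div_eq_mul_inv, Complex.ofReal_inv, Complex.ofReal_natCast, Complex.inv_cpow]
  simp [Complex.natCast_arg, Real.pi_ne_zero.symm]

lemma riemannZeta₁_eq {s : ℂ} (hs : s ≠ 1) : riemannZeta₁ s = (s - 1) * riemannZeta s := by
  rw [riemannZeta_eq_inv_sub_mul hs, mul_inv_cancel_left₀ (sub_ne_zero.2 hs)]

/-- Stated without division and with the entire function `(s - 1) ζ(s)`, so that it can be continued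
across `s = 1` and across possible zeros of `ζ`. -/
lemma mellin_moebiusExpSum {s : ℂ} (h1 : 1 < s.re) (h2 : s.re < 2) :
    mellin moebiusExpSum (-s) * (s * riemannZeta₁ s) = Complex.Gamma (2 - s) := by
  have hs : s ≠ 1 := by rintro rfl; simp at h1
  have hζ := riemannZeta_ne_zero_of_one_lt_re h1
  have h := mellin_expRem (w := -s) (by simp; linarith) (by simp; linarith)
  rw [mellin_moebiusExpSum_eq_mul h1 h2, riemannZeta₁_eq hs, show 2 - s = -s + 2 by ring, ← h]
  field_simp
  ring

/-! ### From the growth hypothesis to the zero-free half-plane -/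

lemma locallyIntegrableOn_moebiusExpSum : LocallyIntegrableOn moebiusExpSum (Ioi 0) :=
  continuousOn_moebiusExpSum.locallyIntegrableOn measurableSet_Ioi

lemma moebiusExpSum_isBigO_zero : moebiusExpSum =O[𝓝[>] 0] fun x : ℝ ↦ x ^ (-(-2 : ℝ)) :=
  isBigO_rpow_of_le self_mem_nhdsWithin fun x hx ↦ by
    simpa only [neg_neg] using norm_moebiusExpSum_le one_lt_two le_rfl hx.le

lemma FVBDHypothesis.moebiusExpSum_isBigO (h : FVBDHypothesis) {ε : ℝ} (hε : 0 < ε) :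
    moebiusExpSum =O[atTop] fun x : ℝ ↦ x ^ (1 / 2 + ε) := by
  obtain ⟨C, hC0, hC⟩ := h ε hε
  obtain ⟨C₁, hC₁0, hC₁⟩ := exists_norm_moebiusExpSum_sub_floor_le
  obtain ⟨C₂, hC₂0, hC₂⟩ := exists_norm_invZetaDiff_sub_le
  refine IsBigO.of_bound (C₁ + C₂ + C) ?_
  filter_upwards [eventually_ge_atTop 1] with x hx
  have hx0 : 0 ≤ x := by linarith
  have hn : 1 ≤ ⌊x⌋₊ := Nat.le_floor (by simpa using hx)
  have hnx : (⌊x⌋₊ : ℝ) ≤ x := Nat.floor_le hx0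
  have hpow : x ^ (1 / 2 : ℝ) ≤ x ^ (1 / 2 + ε) :=
    Real.rpow_le_rpow_of_exponent_le hx (by linarith)
  have i1 := hC₁ x hx0
  have i2 := hC₂ _ hn
  have i3 := (hC _ hn).le
  have j1 : C₁ * x ^ (1 / 2 : ℝ) ≤ C₁ * x ^ (1 / 2 + ε) := by gcongr
  have j2 : C₂ * (⌊x⌋₊ : ℝ) ^ (1 / 2 : ℝ) ≤ C₂ * x ^ (1 / 2 + ε) :=
    mul_le_mul_of_nonneg_left ((Real.rpow_le_rpow (by positivity) hnx (by norm_num)).trans hpow)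
      hC₂0
  have j3 : C * (⌊x⌋₊ : ℝ) ^ (1 / 2 + ε) ≤ C * x ^ (1 / 2 + ε) := by gcongr
  rw [Real.norm_of_nonneg (by positivity)]
  have e : moebiusExpSum x = (moebiusExpSum x - moebiusExpSum ⌊x⌋₊) -
      (invZetaDiff ⌊x⌋₊ - moebiusExpSum ⌊x⌋₊) + invZetaDiff ⌊x⌋₊ := by ring
  rw [e]
  refine (norm_add_le _ _).trans ?_
  have := norm_sub_le (moebiusExpSum x - moebiusExpSum ⌊x⌋₊)
    (invZetaDiff ⌊x⌋₊ - moebiusExpSum ⌊x⌋₊)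
  linarith

lemma FVBDHypothesis.zetaZeroFreeHalfPlane (h : FVBDHypothesis) : ZetaZeroFreeHalfPlane := by
  intro s hs hs1 hζ
  norm_num at hs
  have hs2 : s.re < 2 := by
    by_contra! h2
    exact riemannZeta_ne_zero_of_one_lt_re (by linarith) hζ
  set U : Set ℂ := {z | 1 / 2 < z.re} ∩ {z | z.re < 2}
  have hUo : IsOpen U :=
    (isOpen_lt continuous_const Complex.continuous_re).inter
      (isOpen_lt Complex.continuous_re continuous_const)
  have hUc : IsPreconnected U :=
    ((convex_halfSpace_re_gt _).inter (convex_halfSpace_re_lt _)).isPreconnected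
  have hF : DifferentiableOn ℂ (fun z ↦ mellin moebiusExpSum (-z) * (z * riemannZeta₁ z)) U := by
    rintro z ⟨hz1, hz2⟩
    simp only [Set.mem_ofPred_eq] at hz1 hz2
    refine DifferentiableAt.differentiableWithinAt (DifferentiableAt.mul ?_ (by fun_prop))
    refine DifferentiableAt.comp z (g := mellin moebiusExpSum) (f := fun z ↦ -z) ?_ (by fun_prop)
    -- Half the distance from `z` to the critical line leaves room for holomorphy of the transform
    -- at `-z`.
    have hO := h.moebiusExpSum_isBigO (ε := (z.re - 1 / 2) / 2) (by linarith)
    rw [show 1 / 2 + (z.re - 1 / 2) / 2 = -(-(1 / 2 + (z.re - 1 / 2) / 2)) by ring] at hO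
    exact mellin_differentiableAt_of_isBigO_rpow locallyIntegrableOn_moebiusExpSum hO
      (by simp; linarith) moebiusExpSum_isBigO_zero (by simp; linarith)
  have hG : DifferentiableOn ℂ (fun z ↦ Complex.Gamma (2 - z)) U := by
    rintro z ⟨hz1, hz2⟩
    simp only [Set.mem_ofPred_eq] at hz1 hz2
    refine DifferentiableAt.differentiableWithinAt ?_
    refine DifferentiableAt.comp z (g := Complex.Gamma) (f := fun z ↦ 2 - z) ?_ (by fun_prop)
    refine Complex.differentiableAt_Gamma _ fun m hm ↦ ?_
    have := congrArg Complex.re hm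
    simp at this
    have : (0 : ℝ) ≤ m := Nat.cast_nonneg m
    linarith
  have hEq := (hF.analyticOnNhd hUo).eqOn_of_preconnected_of_eventuallyEq (hG.analyticOnNhd hUo)
    hUc (z₀ := 3 / 2) (by constructor <;> norm_num) (by
      have : {z : ℂ | 1 < z.re} ∩ {z | z.re < 2} ∈ 𝓝 (3 / 2 : ℂ) :=
        ((isOpen_lt continuous_const Complex.continuous_re).inter
          (isOpen_lt Complex.continuous_re continuous_const)).mem_nhds
          (by constructor <;> norm_num)
      filter_upwards [this] with z hz
      exact mellin_moebiusExpSum hz.1 hz.2)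
  -- At a zero the left side vanishes, while `Γ(2 - s)` does not since `Re (2 - s) > 0`.
  have := hEq (show s ∈ U from ⟨hs, hs2⟩)
  simp only [riemannZeta₁_eq hs1, hζ, mul_zero] at this
  exact Complex.Gamma_ne_zero_of_re_pos (by simp; linarith) this.symm

/-! ### Upper bounds for `ζ` and decay of `Γ` -/

lemma sum_Icc_one_isBigO :
    (fun n : ℕ ↦ ∑ k ∈ Finset.Icc 1 n, (1 : ℕ → ℝ) k) =O[atTop] fun n ↦ (n : ℝ) ^ (1 : ℝ) := by
  simpa using isBigO_refl _ _

/-- The fractional part on `(1, ∞)`, extended by zero. -/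
noncomputable def fractTail : ℝ → ℂ := indicator (Ioi 1) fun t ↦ ((Int.fract t : ℝ) : ℂ)

lemma norm_fractTail_le (t : ℝ) : ‖fractTail t‖ ≤ 1 := by
  unfold fractTail
  refine (norm_indicator_le_norm_self _ _).trans ?_
  rw [Complex.norm_real, Real.norm_of_nonneg (Int.fract_nonneg t)]
  exact (Int.fract_lt_one t).le

lemma measurable_fractTail : Measurable fractTail :=
  (Complex.measurable_ofReal.comp measurable_fract).indicator measurableSet_Ioi

lemma fractTail_isBigO_zero (b : ℝ) : fractTail =O[𝓝[>] 0] fun t : ℝ ↦ t ^ b := by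
  refine IsBigO.of_bound 0 ?_
  filter_upwards [mem_nhdsWithin_of_mem_nhds (Iio_mem_nhds one_pos)] with t ht
  have : fractTail t = 0 := indicator_of_notMem (by simpa using le_of_lt ht) _
  simp [this]

lemma fractTail_isBigO_atTop : fractTail =O[atTop] fun t : ℝ ↦ t ^ (-(0 : ℝ)) := by
  refine IsBigO.of_bound 1 (Eventually.of_forall fun t ↦ ?_)
  simpa using norm_fractTail_le t

lemma locallyIntegrableOn_fractTail : LocallyIntegrableOn fractTail (Ioi 0) :=
  LocallyIntegrable.locallyIntegrableOn (((locallyIntegrable_const (1 : ℝ)).mono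
    measurable_fractTail.aestronglyMeasurable
    (Eventually.of_forall fun t ↦ by simpa using norm_fractTail_le t))) _

lemma mellin_fractTail_eq (s : ℂ) :
    mellin fractTail (-s) = ∫ t in Ioi (1 : ℝ), (t : ℂ) ^ (-s - 1) * ((Int.fract t : ℝ) : ℂ) := by
  have : (fun t : ℝ ↦ (t : ℂ) ^ (-s - 1) • fractTail t) =
      indicator (Ioi 1) fun t : ℝ ↦ (t : ℂ) ^ (-s - 1) * ((Int.fract t : ℝ) : ℂ) := by
    ext t
    simp only [fractTail, smul_eq_mul, indicator]
    split_ifs <;> simp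
  rw [mellin, this, setIntegral_indicator measurableSet_Ioi]
  congr 2
  ext t
  simp only [mem_inter_iff, mem_Ioi]
  exact ⟨fun h ↦ h.2, fun h ↦ ⟨by linarith, h⟩⟩

lemma norm_mellin_fractTail_le {s : ℂ} (hs : 0 < s.re) :
    ‖mellin fractTail (-s)‖ ≤ 1 / s.re := by
  rw [mellin_fractTail_eq]
  have hI := integral_Ioi_rpow_of_lt (a := -s.re - 1) (by linarith) one_pos
  have hi := integrableOn_Ioi_rpow_of_lt (a := -s.re - 1) (by linarith) one_pos
  have : ∫ t in Ioi (1 : ℝ), t ^ (-s.re - 1) = 1 / s.re := by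
    rw [hI, Real.one_rpow]
    have : -s.re - 1 + 1 = -s.re := by ring
    rw [this, neg_div_neg_eq]
  rw [← this]
  refine norm_integral_le_of_norm_le hi ?_
  refine (ae_restrict_iff' measurableSet_Ioi).2 (Eventually.of_forall fun t ht ↦ ?_)
  have ht0 : (0 : ℝ) < t := zero_lt_one.trans ht
  rw [norm_mul, Complex.norm_cpow_eq_rpow_re_of_pos ht0, Complex.norm_real,
    Real.norm_of_nonneg (Int.fract_nonneg t)]
  simp only [Complex.sub_re, Complex.neg_re, Complex.one_re]
  exact mul_le_of_le_one_right (by positivity) (Int.fract_lt_one t).le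

/-- Abel summation gives `ζ(s) = s ∫ ⌊t⌋ t^(-s-1)` over `t > 1`; then write `⌊t⌋ = t - fract t`. -/
lemma riemannZeta₁_eq_of_one_lt_re {s : ℂ} (hs : 1 < s.re) :
    riemannZeta₁ s = s - s * (s - 1) * mellin fractTail (-s) := by
  have hs1 : s ≠ 1 := by rintro rfl; simp at hs
  have h := LSeries_eq_mul_integral_of_nonneg 1 zero_le_one hs sum_Icc_one_isBigO
    (fun _ ↦ zero_le_one)
  have e1 : LSeries (fun n ↦ (((1 : ℕ → ℝ) n : ℝ) : ℂ)) s = riemannZeta s := by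
    rw [← LSeries_one_eq_riemannZeta hs]
    congr 1
  have i1 : IntegrableOn (fun t : ℝ ↦ (t : ℂ) ^ (-s)) (Ioi 1) :=
    integrableOn_Ioi_cpow_of_lt (by simpa using hs) one_pos
  have i2 : IntegrableOn (fun t : ℝ ↦ (t : ℂ) ^ (-s - 1) * ((Int.fract t : ℝ) : ℂ)) (Ioi 1) := by
    have i3 : IntegrableOn (fun t : ℝ ↦ (t : ℂ) ^ (-s - 1)) (Ioi 1) :=
      integrableOn_Ioi_cpow_of_lt (by simp; linarith) one_pos
    refine i3.mul_bdd (c := 1)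
      (Complex.measurable_ofReal.comp measurable_fract).aestronglyMeasurable
      (Eventually.of_forall fun t ↦ ?_)
    rw [Complex.norm_real, Real.norm_of_nonneg (Int.fract_nonneg t)]
    exact (Int.fract_lt_one t).le
  have e2 : ∫ t in Ioi (1 : ℝ), (∑ k ∈ Finset.Icc 1 ⌊t⌋₊, (((1 : ℕ → ℝ) k : ℝ) : ℂ)) *
      (t : ℂ) ^ (-(s + 1)) = 1 / (s - 1) - mellin fractTail (-s) := by
    have : 1 / (s - 1) = ∫ t in Ioi (1 : ℝ), (t : ℂ) ^ (-s) := by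
      rw [integral_Ioi_cpow_of_lt (by simpa using hs) one_pos]
      simp only [Complex.ofReal_one, Complex.one_cpow]
      rw [show -s + 1 = -(s - 1) by ring, neg_div_neg_eq]
    rw [this, mellin_fractTail_eq, ← integral_sub i1 i2]
    refine setIntegral_congr_fun measurableSet_Ioi fun t ht ↦ ?_
    have ht0 : (0 : ℝ) < t := zero_lt_one.trans ht
    have hfl : ((⌊t⌋₊ : ℝ) : ℂ) = t - ((Int.fract t : ℝ) : ℂ) := by
      rw [← Complex.ofReal_sub, Int.self_sub_fract, natCast_floor_eq_intCast_floor ht0.le]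
    have hp : (t : ℂ) ^ (-s) = (t : ℂ) ^ (-s - 1) * t := by
      have := Complex.cpow_add (x := (t : ℂ)) (-s - 1) 1 (by exact_mod_cast ht0.ne')
      rw [Complex.cpow_one] at this
      rw [← this]; congr 1; ring
    simp only [Pi.one_apply, Complex.ofReal_one, Finset.sum_const, Nat.card_Icc,
      add_tsub_cancel_right, nsmul_eq_mul, mul_one]
    rw [hp, show -(s + 1) = -s - 1 by ring, show ((⌊t⌋₊ : ℕ) : ℂ) = ((⌊t⌋₊ : ℝ) : ℂ) by simp, hfl]
    ring
  rw [e1, e2] at h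
  rw [riemannZeta₁_eq hs1, h]
  field_simp [sub_ne_zero.2 hs1]

/-- The fractional part is bounded, so its transform is holomorphic on `Re s > 0`, and the formula
extends by the identity theorem. -/
lemma riemannZeta₁_eq_of_re_pos {s : ℂ} (hs : 0 < s.re) :
    riemannZeta₁ s = s - s * (s - 1) * mellin fractTail (-s) := by
  set U : Set ℂ := {z | 0 < z.re}
  have hUo : IsOpen U := isOpen_lt continuous_const Complex.continuous_re
  have hUc : IsPreconnected U := (convex_halfSpace_re_gt _).isPreconnected
  have hF : DifferentiableOn ℂ (fun z ↦ z - z * (z - 1) * mellin fractTail (-z)) U := by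
    intro z hz
    have hz : 0 < z.re := hz
    have hd : DifferentiableAt ℂ (fun z ↦ mellin fractTail (-z)) z := by
      refine DifferentiableAt.comp z (g := mellin fractTail) (f := fun z ↦ -z) ?_ (by fun_prop)
      exact mellin_differentiableAt_of_isBigO_rpow (b := -z.re - 1) locallyIntegrableOn_fractTail
        fractTail_isBigO_atTop (by simpa using hz) (fractTail_isBigO_zero _) (by simp)
    exact DifferentiableAt.differentiableWithinAt (by fun_prop)
  refine (differentiable_riemannZeta₁.differentiableOn.analyticOnNhd
    hUo).eqOn_of_preconnected_of_eventuallyEq (hF.analyticOnNhd hUo) hUc (z₀ := 2)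
    (by simp [U]) ?_ hs
  filter_upwards [(isOpen_lt continuous_const Complex.continuous_re).mem_nhds
    (show (2 : ℂ) ∈ {z : ℂ | 1 < z.re} by simp)] with z hz
  exact riemannZeta₁_eq_of_one_lt_re hz

lemma norm_riemannZeta₁_le {s : ℂ} (hs : 0 < s.re) :
    ‖riemannZeta₁ s‖ ≤ ‖s‖ + ‖s‖ * ‖s - 1‖ / s.re := by
  rw [riemannZeta₁_eq_of_re_pos hs]
  refine (norm_sub_le _ _).trans ?_
  rw [norm_mul, norm_mul, ← mul_one_div (‖s‖ * ‖s - 1‖)]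
  gcongr
  exact norm_mellin_fractTail_le hs

lemma norm_Gamma_le {z : ℂ} (hz : 0 < z.re) : ‖Complex.Gamma z‖ ≤ Real.Gamma z.re := by
  rw [Complex.Gamma_eq_integral hz, Complex.GammaIntegral, Real.Gamma_eq_integral hz]
  refine (norm_integral_le_integral_norm _).trans_eq ?_
  refine setIntegral_congr_fun measurableSet_Ioi fun t ht ↦ ?_
  rw [norm_mul, Complex.norm_cpow_eq_rpow_re_of_pos ht, Complex.norm_real,
    Real.norm_of_nonneg (Real.exp_pos _).le]
  simp

/-- The Gamma function decays faster than any power of the imaginary part in vertical strips. -/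
lemma exists_norm_Gamma_mul_pow_le (N : ℕ) : ∀ a b : ℝ, 0 < a →
    ∃ C : ℝ, ∀ z : ℂ, a ≤ z.re → z.re ≤ b → ‖Complex.Gamma z‖ * (1 + |z.im|) ^ N ≤ C := by
  induction N with
  | zero =>
    intro a b ha
    have hc : ContinuousOn Real.Gamma (Icc a b) := fun x hx ↦
      (Real.differentiableAt_Gamma fun m hm ↦ by
        have : (0 : ℝ) ≤ m := Nat.cast_nonneg m
        linarith [hx.1]).continuousAt.continuousWithinAt
    obtain ⟨C, hC⟩ := (isCompact_Icc.image_of_continuousOn hc).bddAbove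
    refine ⟨C, fun z h1 h2 ↦ ?_⟩
    rw [pow_zero, mul_one]
    exact (norm_Gamma_le (ha.trans_le h1)).trans (hC ⟨z.re, ⟨h1, h2⟩, rfl⟩)
  | succ N ih =>
    intro a b ha
    -- `Γ(z + 1) = z Γ(z)` trades a unit shift of the strip for one power of `|z|`, so the induction
    -- must range over all strips.
    obtain ⟨C, hC⟩ := ih (a + 1) (b + 1) (by linarith)
    refine ⟨C * (1 / a + 1), fun z h1 h2 ↦ ?_⟩
    have hz : z ≠ 0 := by rintro rfl; simp at h1; linarith
    have h := hC (z + 1) (by simpa using h1) (by simpa using h2)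
    rw [Complex.Gamma_add_one z hz, norm_mul] at h
    simp only [Complex.add_im, Complex.one_im, add_zero] at h
    have hz1 : a ≤ ‖z‖ := h1.trans (Complex.re_le_norm z)
    have hz2 : 1 + |z.im| ≤ ‖z‖ * (1 / a + 1) := by
      have : 1 ≤ ‖z‖ * (1 / a) := by rw [mul_one_div]; exact (one_le_div ha).2 hz1
      linarith [Complex.abs_im_le_norm z]
    calc ‖Complex.Gamma z‖ * (1 + |z.im|) ^ (N + 1)
        = ‖Complex.Gamma z‖ * (1 + |z.im|) ^ N * (1 + |z.im|) := by ring
      _ ≤ ‖Complex.Gamma z‖ * (1 + |z.im|) ^ N * (‖z‖ * (1 / a + 1)) := by gcongr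
      _ = ‖z‖ * ‖Complex.Gamma z‖ * (1 + |z.im|) ^ N * (1 / a + 1) := by ring
      _ ≤ _ := by gcongr

/-! ### Lower bounds for `ζ` from the absence of zeros -/

/-- Take for `g` a primitive of `f'/f` on the disc; then `f exp (-g)` has zero derivative. -/
lemma exists_eq_mul_exp_of_ne_zero_on_ball {f : ℂ → ℂ} {c : ℂ} {R : ℝ} (hR : 0 < R)
    (hf : DifferentiableOn ℂ f (Metric.ball c R)) (h0 : ∀ z ∈ Metric.ball c R, f z ≠ 0) :
    ∃ g : ℂ → ℂ, DifferentiableOn ℂ g (Metric.ball c R) ∧ g c = 0 ∧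
      ∀ z ∈ Metric.ball c R, f z = f c * Complex.exp (g z) := by
  have hc : c ∈ Metric.ball c R := Metric.mem_ball_self hR
  have hd : DifferentiableOn ℂ (fun z ↦ deriv f z / f z) (Metric.ball c R) :=
    (hf.deriv Metric.isOpen_ball).div hf h0
  obtain ⟨g, hgc, hg⟩ := hd.isExactOn_ball.with_val_at c 0
  refine ⟨g, fun z hz ↦ (hg z hz).differentiableAt.differentiableWithinAt, hgc, fun z hz ↦ ?_⟩
  have hder : ∀ w ∈ Metric.ball c R, HasDerivAt (fun w ↦ f w * Complex.exp (-g w)) 0 w := by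
    intro w hw
    have h1 := (hf.differentiableAt (Metric.isOpen_ball.mem_nhds hw)).hasDerivAt
    have h2 := h1.mul ((hg w hw).neg.cexp)
    have e : deriv f w * Complex.exp (-g w) +
        f w * (Complex.exp (-g w) * -(deriv f w / f w)) = 0 := by
      have := h0 w hw
      field_simp
      ring
    exact h2.congr_deriv e
  have hconst := Metric.isOpen_ball.is_const_of_deriv_eq_zero
    (convex_ball c R).isPreconnected
    (fun w hw ↦ (hder w hw).differentiableAt.differentiableWithinAt)
    (fun w hw ↦ (hder w hw).deriv) hz hc
  simp only [hgc, neg_zero, Complex.exp_zero, mul_one] at hconst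
  rw [← hconst, mul_assoc, ← Complex.exp_add, neg_add_cancel, Complex.exp_zero, mul_one]

/-- A lower bound of Harnack type for a zero-free holomorphic function on a disc. -/
lemma norm_mul_exp_le_norm_of_ne_zero_on_ball {f : ℂ → ℂ} {c : ℂ} {R L : ℝ} (hR : 0 < R)
    (hL : 0 < L) (hf : DifferentiableOn ℂ f (Metric.ball c R))
    (h0 : ∀ z ∈ Metric.ball c R, f z ≠ 0)
    (hM : ∀ z ∈ Metric.ball c R, ‖f z‖ ≤ ‖f c‖ * Real.exp L) {z : ℂ}
    (hz : z ∈ Metric.ball c R) :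
    ‖f c‖ * Real.exp (-(2 * L * ‖z - c‖ / (R - ‖z - c‖))) ≤ ‖f z‖ := by
  obtain ⟨g, hg, hgc, hfg⟩ := exists_eq_mul_exp_of_ne_zero_on_ball hR hf h0
  have hfc : 0 < ‖f c‖ := norm_pos_iff.2 (h0 c (Metric.mem_ball_self hR))
  have hmaps : ∀ w ∈ Metric.ball (0 : ℂ) R, w + c ∈ Metric.ball c R := fun w hw ↦ by
    simpa using hw
  -- The bound on `‖f‖` says that the logarithm `g` of `f / f c` has real part at most `L`;
  -- Borel–Carathéodory turns this into a bound on `‖g‖`.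
  have hB := Complex.borelCaratheodory_zero (f := fun w ↦ g (w + c)) (z := z - c) hL
    (hg.comp (by fun_prop) hmaps)
    (fun w hw ↦ by
      have h := hM _ (hmaps w hw)
      rw [hfg _ (hmaps w hw), norm_mul, Complex.norm_exp] at h
      exact Real.exp_le_exp.1 (le_of_mul_le_mul_left h hfc)) hR (by simpa [dist_eq_norm] using hz)
    (by simpa using hgc)
  rw [sub_add_cancel] at hB
  rw [hfg z hz, norm_mul, Complex.norm_exp]
  gcongr
  linarith [neg_abs_le (g z).re, Complex.abs_re_le_norm (g z)]

lemma exists_one_le_mul_norm_riemannZeta :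
    ∃ D : ℝ, 1 ≤ D ∧ ∀ s : ℂ, s.re = 2 → 1 ≤ D * ‖riemannZeta s‖ := by
  refine ⟨1 + ∑' m : ℕ, 1 / (m : ℝ) ^ (2 : ℝ),
    le_add_of_nonneg_right (tsum_nonneg fun m ↦ by positivity), fun s hs ↦ ?_⟩
  have hs1 : 1 < s.re := by linarith
  have h : ‖1 / riemannZeta s‖ ≤ ∑' m : ℕ, 1 / (m : ℝ) ^ (2 : ℝ) := by
    rw [← (hasSum_term_moebius hs1).tsum_eq]
    refine tsum_of_norm_bounded (Real.summable_one_div_nat_rpow.2 one_lt_two).hasSum fun m ↦ ?_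
    rw [LSeries.norm_term_eq]
    split_ifs with hm
    · positivity
    · rw [hs]
      gcongr
      exact norm_moebius_le m
  rw [norm_div, norm_one, div_le_iff₀ (norm_pos_iff.2 (riemannZeta_ne_zero_of_one_lt_re hs1))] at h
  nlinarith [norm_nonneg (riemannZeta s)]

lemma ZetaZeroFreeHalfPlane.riemannZeta₁_ne_zero (h : ZetaZeroFreeHalfPlane) {s : ℂ}
    (hs : 1 / 2 < s.re) : riemannZeta₁ s ≠ 0 := by
  rcases eq_or_ne s 1 with rfl | h1
  · simp
  · rw [riemannZeta₁_eq h1]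
    exact mul_ne_zero (sub_ne_zero.2 h1) (h s (by simpa using hs) h1)

lemma norm_riemannZeta₁_le_of_mem_ball {t : ℝ} {z : ℂ}
    (hz : z ∈ Metric.ball (2 + t * Complex.I) (3 / 2)) :
    ‖riemannZeta₁ z‖ ≤ 48 * (1 + |t|) ^ 2 := by
  have hd : ‖z - (2 + t * Complex.I)‖ < 3 / 2 := by simpa [dist_eq_norm] using hz
  have hre : 1 / 2 < z.re := by
    have := (Complex.abs_re_le_norm _).trans_lt hd
    simp [abs_lt] at this
    linarith [this.1]
  have hti : ‖(t : ℂ) * Complex.I‖ = |t| := by simp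
  have h1 : ‖z‖ ≤ 4 + |t| := by
    have e : z = (z - (2 + t * Complex.I)) + (2 + t * Complex.I) := by ring
    have i1 := norm_add_le (z - (2 + t * Complex.I)) (2 + t * Complex.I)
    have i2 := norm_add_le (2 : ℂ) (t * Complex.I)
    rw [← e] at i1
    rw [hti, Complex.norm_ofNat] at i2
    linarith
  have h2 : ‖z - 1‖ ≤ 4 + |t| := by
    have e : z - 1 = (z - (2 + t * Complex.I)) + (1 + t * Complex.I) := by ring
    have i1 := norm_add_le (z - (2 + t * Complex.I)) (1 + t * Complex.I)
    have i2 := norm_add_le (1 : ℂ) (t * Complex.I)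
    rw [← e] at i1
    rw [hti, norm_one] at i2
    linarith
  refine (norm_riemannZeta₁_le (by linarith)).trans ?_
  have h3 : ‖z‖ * ‖z - 1‖ / z.re ≤ (4 + |t|) * (4 + |t|) / (1 / 2) := by gcongr
  have := abs_nonneg t
  nlinarith

/-- The disc of radius `3/2` about `2 + it` lies in the zero-free half-plane and touches its
boundary line. There the logarithm of the upper bound is `O(log (2 + |t|))`, so the Harnack-type
bound loses only a power of `1 + |t|`. -/
lemma ZetaZeroFreeHalfPlane.exists_one_le_mul_norm_riemannZeta₁ (h : ZetaZeroFreeHalfPlane)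
    {ε : ℝ} (hε : 0 < ε) :
    ∃ C : ℝ, 0 < C ∧ ∃ A : ℕ, ∀ s : ℂ, 1 / 2 + ε ≤ s.re → s.re ≤ 2 →
      1 ≤ C * (1 + |s.im|) ^ A * ‖riemannZeta₁ s‖ := by
  obtain ⟨D, hD1, hD⟩ := exists_one_le_mul_norm_riemannZeta
  -- With `r = 2 - Re s ≤ 3/2 - ε`, the Harnack exponent satisfies `2r / (3/2 - r) ≤ 3/ε`.
  obtain ⟨A, hA⟩ := exists_nat_ge (3 / ε)
  refine ⟨D * (48 * D) ^ A, by positivity, 2 * A, fun s hs1 hs2 ↦ ?_⟩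
  set t := s.im
  set c : ℂ := 2 + t * Complex.I with hc
  have hcre : c.re = 2 := by simp [hc]
  have hc1 : c ≠ 1 := by intro h; rw [h] at hcre; norm_num at hcre
  have hsc : s - c = ((s.re - 2 : ℝ) : ℂ) := by apply Complex.ext <;> simp [hc, t]
  have hr : ‖s - c‖ = 2 - s.re := by
    rw [hsc, Complex.norm_real, Real.norm_eq_abs, abs_of_nonpos (by linarith)]; ring
  have hball : ∀ z ∈ Metric.ball c (3 / 2), 1 / 2 < z.re := fun z hz ↦ by
    rw [Metric.mem_ball, dist_eq_norm] at hz
    have := (Complex.abs_re_le_norm _).trans_lt hz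
    rw [Complex.sub_re, hcre, abs_lt] at this
    linarith [this.1]
  have hfc : 1 ≤ D * ‖riemannZeta₁ c‖ := by
    rw [riemannZeta₁_eq hc1, norm_mul]
    have i1 : 1 ≤ ‖c - 1‖ := by
      have := Complex.re_le_norm (c - 1)
      rw [Complex.sub_re, hcre] at this
      norm_num at this
      exact this
    have i2 := hD c hcre
    nlinarith
  -- The factor `D` converts the bound on the disc into one relative to the value at the centre, as
  -- `1 ≤ D * ‖riemannZeta₁ c‖`.
  set T := 48 * D * (1 + |t|) ^ 2 with hT
  have hT1 : 1 < T := by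
    have : 1 ≤ (1 + |t|) ^ 2 := one_le_pow₀ (by linarith [abs_nonneg t])
    nlinarith
  have hlow := norm_mul_exp_le_norm_of_ne_zero_on_ball (f := riemannZeta₁) (c := c) (R := 3 / 2)
    (by norm_num) (Real.log_pos hT1) differentiable_riemannZeta₁.differentiableOn
    (fun z hz ↦ h.riemannZeta₁_ne_zero (hball z hz))
    (fun z hz ↦ by
      rw [Real.exp_log (by linarith)]
      refine (norm_riemannZeta₁_le_of_mem_ball hz).trans ?_
      have : 0 ≤ 48 * (1 + |t|) ^ 2 := by positivity
      rw [hT]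
      nlinarith)
    (z := s) (by rw [Metric.mem_ball, dist_eq_norm, hr]; linarith)
  rw [hr] at hlow
  have hexp : Real.exp (2 * Real.log T * (2 - s.re) / (3 / 2 - (2 - s.re))) ≤ T ^ A := by
    rw [← Real.rpow_natCast, Real.rpow_def_of_pos (by linarith)]
    gcongr
    have hl := Real.log_pos hT1
    rw [mul_comm 2, mul_assoc, mul_div_assoc]
    gcongr
    refine le_trans ?_ hA
    gcongr <;> linarith
  rw [Real.exp_neg] at hlow
  set E := Real.exp (2 * Real.log T * (2 - s.re) / (3 / 2 - (2 - s.re)))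
  have hE : 0 < E := Real.exp_pos _
  rw [← div_eq_mul_inv, div_le_iff₀ hE] at hlow
  calc 1 ≤ D * ‖riemannZeta₁ c‖ := hfc
    _ ≤ D * (‖riemannZeta₁ s‖ * T ^ A) := by
        gcongr
        exact hlow.trans (by gcongr)
    _ = _ := by rw [hT, mul_pow, ← pow_mul]; ring

/-! ### Contour shift and Mellin inversion -/

/-- Shifting a vertical line of integration inside a strip in which the integrand is holomorphic
and decays quadratically. -/
lemma integral_vertical_eq_of_norm_le {f : ℂ → ℂ} {a b C : ℝ} (hab : a ≤ b)
    (hf : DifferentiableOn ℂ f {z | a ≤ z.re ∧ z.re ≤ b})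
    (hC : ∀ z : ℂ, a ≤ z.re → z.re ≤ b → ‖f z‖ ≤ C * (1 + z.im ^ 2)⁻¹) :
    ∫ y : ℝ, f (a + y * Complex.I) = ∫ y : ℝ, f (b + y * Complex.I) := by
  have hint : ∀ c : ℝ, a ≤ c → c ≤ b → Integrable fun y : ℝ ↦ f (c + y * Complex.I) := by
    intro c h1 h2
    refine (integrable_inv_one_add_sq.const_mul C).mono' ?_ (Eventually.of_forall fun y ↦ ?_)
    · refine Continuous.aestronglyMeasurable ?_
      exact hf.continuousOn.comp_continuous (by fun_prop) fun y ↦ by simp [h1, h2]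
    · simpa using hC (c + y * Complex.I) (by simpa using h1) (by simpa using h2)
  have hlim : ∀ c : ℝ, a ≤ c → c ≤ b → Tendsto (fun T : ℝ ↦ ∫ y in -T..T, f (c + y * Complex.I))
      atTop (𝓝 (∫ y : ℝ, f (c + y * Complex.I))) := fun c h1 h2 ↦
    intervalIntegral_tendsto_integral (hint c h1 h2) tendsto_neg_atTop_atBot tendsto_id
  have hC0 : 0 ≤ C := by
    simpa using (norm_nonneg _).trans (hC a (by simp) (by simpa using hab))
  -- Taking `ψ` to be `T` or `-T` treats the top and bottom edges together.
  have hhor : ∀ ψ : ℝ → ℝ, (∀ T, ψ T ^ 2 = T ^ 2) →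
      Tendsto (fun T : ℝ ↦ ∫ x in a..b, f (x + ψ T * Complex.I)) atTop (𝓝 0) := by
    intro ψ hψ
    have h0 : Tendsto (fun T : ℝ ↦ C * (1 + T ^ 2)⁻¹ * |b - a|) atTop (𝓝 0) := by
      have : Tendsto (fun T : ℝ ↦ 1 + T ^ 2) atTop atTop :=
        tendsto_atTop_add_const_left _ _ (tendsto_pow_atTop two_ne_zero)
      simpa using (this.inv_tendsto_atTop.const_mul C).mul_const |b - a|
    refine squeeze_zero_norm (fun T ↦ ?_) h0
    refine intervalIntegral.norm_integral_le_of_norm_le_const fun x hx ↦ ?_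
    rw [uIoc_of_le hab] at hx
    simpa [hψ] using hC (x + ψ T * Complex.I) (by simpa using hx.1.le) (by simpa using hx.2)
  have hrect : ∀ T : ℝ, (∫ x in a..b, f (x + (-T : ℝ) * Complex.I)) -
      (∫ x in a..b, f (x + T * Complex.I)) + Complex.I * (∫ y in -T..T, f (b + y * Complex.I)) -
      Complex.I * (∫ y in -T..T, f (a + y * Complex.I)) = 0 := by
    intro T
    have := Complex.integral_boundary_rect_eq_zero_of_differentiableOn f
      (a + (-T : ℝ) * Complex.I) (b + T * Complex.I) (hf.mono fun z hz ↦ by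
        have := hz.1
        simpa [uIcc_of_le hab] using this)
    simpa using this
  have hl := (((hhor (fun T ↦ -T) (by simp)).sub (hhor id (by simp))).add
    ((hlim b hab le_rfl).const_mul Complex.I)).sub ((hlim a le_rfl hab).const_mul Complex.I)
  have h0 := tendsto_nhds_unique (hl.congr hrect) tendsto_const_nhds
  rw [sub_zero, zero_add, ← mul_sub, mul_eq_zero, or_iff_right Complex.I_ne_zero, sub_eq_zero] at h0
  exact h0.symm

/-- The continuation of `s ↦ mellin moebiusExpSum (-s)`, equal to `Γ (-s) / ζ (s)`. -/
noncomputable def moebiusExpMellin (s : ℂ) : ℂ := Complex.Gamma (2 - s) / (s * riemannZeta₁ s)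

lemma mellin_moebiusExpSum_eq {s : ℂ} (h1 : 1 < s.re) (h2 : s.re < 2) :
    mellin moebiusExpSum (-s) = moebiusExpMellin s := by
  have hs : s ≠ 1 := by rintro rfl; simp at h1
  have hs0 : s ≠ 0 := by rintro rfl; norm_num at h1
  refine (eq_div_iff ?_).2 (mellin_moebiusExpSum h1 h2)
  rw [riemannZeta₁_eq hs]
  exact mul_ne_zero hs0 (mul_ne_zero (sub_ne_zero.2 hs) (riemannZeta_ne_zero_of_one_lt_re h1))

lemma ZetaZeroFreeHalfPlane.differentiableAt_moebiusExpMellin (h : ZetaZeroFreeHalfPlane) {s : ℂ}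
    (h1 : 1 / 2 < s.re) (h2 : s.re < 2) : DifferentiableAt ℂ moebiusExpMellin s := by
  have hs0 : s ≠ 0 := by rintro rfl; norm_num at h1
  refine DifferentiableAt.div ?_ (by fun_prop) (mul_ne_zero hs0 (h.riemannZeta₁_ne_zero h1))
  refine DifferentiableAt.comp s (g := Complex.Gamma) (f := fun z ↦ 2 - z) ?_ (by fun_prop)
  refine Complex.differentiableAt_Gamma _ fun m hm ↦ ?_
  have := congrArg Complex.re hm
  simp at this
  have : (0 : ℝ) ≤ m := Nat.cast_nonneg m
  linarith

lemma ZetaZeroFreeHalfPlane.exists_norm_moebiusExpMellin_le (h : ZetaZeroFreeHalfPlane)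
    {ε : ℝ} (hε : 0 < ε) :
    ∃ C : ℝ, 0 ≤ C ∧ ∀ s : ℂ, 1 / 2 + ε ≤ s.re → s.re ≤ 3 / 2 →
      ‖moebiusExpMellin s‖ ≤ C * (1 + s.im ^ 2)⁻¹ := by
  obtain ⟨C, hC0, A, hC⟩ := h.exists_one_le_mul_norm_riemannZeta₁ hε
  -- `A` powers cancel the growth of the inverse zeta factor, and two more give integrability.
  obtain ⟨B, hB⟩ := exists_norm_Gamma_mul_pow_le (A + 2) (1 / 2) (3 / 2) (by norm_num)
  have hB0 : 0 ≤ B := le_trans (by positivity) (hB 1 (by norm_num) (by norm_num))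
  refine ⟨B * (2 * C), by positivity, fun s h1 h2 ↦ ?_⟩
  have hz := hC s h1 (by linarith)
  have hg := hB (2 - s) (by simp; linarith) (by simp; linarith)
  simp only [Complex.sub_im, Complex.im_ofNat, zero_sub, abs_neg] at hg
  have hs : 1 ≤ 2 * ‖s‖ := by linarith [Complex.re_le_norm s]
  have hζ : 0 < ‖riemannZeta₁ s‖ := norm_pos_iff.2 (h.riemannZeta₁_ne_zero (by linarith))
  have hs0 : 0 < ‖s‖ := by linarith
  have hq : 1 + s.im ^ 2 ≤ (1 + |s.im|) ^ 2 := by nlinarith [abs_nonneg s.im, sq_abs s.im]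
  rw [moebiusExpMellin, norm_div, norm_mul, ← div_eq_mul_inv, div_le_div_iff₀ (by positivity)
    (by positivity)]
  set P := 1 + |s.im|
  have hP : 0 < P := by positivity
  calc ‖Complex.Gamma (2 - s)‖ * (1 + s.im ^ 2)
      ≤ ‖Complex.Gamma (2 - s)‖ * P ^ 2 * 1 := by rw [mul_one]; gcongr
    _ ≤ ‖Complex.Gamma (2 - s)‖ * P ^ 2 * (2 * ‖s‖ * (C * P ^ A * ‖riemannZeta₁ s‖)) := by
        gcongr
        exact one_le_mul_of_one_le_of_one_le hs hz
    _ = ‖Complex.Gamma (2 - s)‖ * P ^ (A + 2) * (2 * C * (‖s‖ * ‖riemannZeta₁ s‖)) := by ring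
    _ ≤ B * (2 * C * (‖s‖ * ‖riemannZeta₁ s‖)) := by gcongr
    _ = _ := by ring

lemma ZetaZeroFreeHalfPlane.moebiusExpSum_eq_integral (h : ZetaZeroFreeHalfPlane) {x : ℝ}
    (hx : 0 < x) :
    moebiusExpSum x = (1 / (2 * Real.pi) : ℝ) • ∫ y : ℝ,
      (x : ℂ) ^ (((3 / 2 : ℝ) : ℂ) + y * Complex.I) *
        moebiusExpMellin (((3 / 2 : ℝ) : ℂ) + y * Complex.I) := by
  have hM : ∀ y : ℝ, mellin moebiusExpSum ((-(3 / 2) : ℝ) + y * Complex.I) =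
      moebiusExpMellin ((3 / 2 : ℝ) + (-y : ℝ) * Complex.I) := fun y ↦ by
    rw [← mellin_moebiusExpSum_eq (by simp; norm_num) (by simp; norm_num)]
    congr 1; push_cast; ring
  have hconv : MellinConvergent moebiusExpSum ((-(3 / 2) : ℝ) : ℂ) := by
    -- Any growth exponent strictly between `1` and `3/2` would serve in place of `5/4`.
    refine mellinConvergent_of_isBigO_rpow (a := -(5 / 4)) (b := -2)
      locallyIntegrableOn_moebiusExpSum
      ?_ (by norm_num) moebiusExpSum_isBigO_zero (by norm_num)
    rw [neg_neg]
    exact isBigO_rpow_of_le (eventually_gt_atTop 0) fun x hx ↦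
      norm_moebiusExpSum_le (by norm_num) (by norm_num) hx.le
  have hvert : Complex.VerticalIntegrable (mellin moebiusExpSum) (-(3 / 2)) := by
    -- With `ε = 1` the strip reduces to the line `Re s = 3/2`.
    obtain ⟨C, -, hC⟩ := h.exists_norm_moebiusExpMellin_le (ε := 1) one_pos
    simp only [Complex.VerticalIntegrable, hM]
    refine (integrable_inv_one_add_sq.const_mul C).mono' ?_ (Eventually.of_forall fun y ↦ ?_)
    · refine Continuous.aestronglyMeasurable ?_
      rw [continuous_iff_continuousAt]
      intro y
      refine ContinuousAt.comp (g := moebiusExpMellin)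
        (h.differentiableAt_moebiusExpMellin ?_ ?_).continuousAt (by fun_prop)
      · simp; norm_num
      · simp; norm_num
    · simpa using hC ((3 / 2 : ℝ) + (-y : ℝ) * Complex.I) (by simp; norm_num) (by simp)
  have hinv := mellinInv_mellin_eq (-(3 / 2)) moebiusExpSum hx hconv hvert
    (continuousOn_moebiusExpSum.continuousAt (Ioi_mem_nhds hx))
  rw [← hinv, mellinInv, ← integral_neg_eq_self]
  congr 1
  refine integral_congr_ae (Eventually.of_forall fun y ↦ ?_)
  simp only [hM, smul_eq_mul, neg_neg]
  congr 2
  push_cast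
  ring

lemma ZetaZeroFreeHalfPlane.exists_norm_moebiusExpSum_le (h : ZetaZeroFreeHalfPlane)
    {ε : ℝ} (hε : 0 < ε) (hε1 : ε ≤ 1) :
    ∃ C : ℝ, 0 ≤ C ∧ ∀ x : ℝ, 1 ≤ x → ‖moebiusExpSum x‖ ≤ C * x ^ (1 / 2 + ε) := by
  obtain ⟨C, hC0, hC⟩ := h.exists_norm_moebiusExpMellin_le hε
  refine ⟨1 / (2 * Real.pi) * (C * Real.pi), by positivity, fun x hx ↦ ?_⟩
  have hx0 : 0 < x := by linarith
  have hxc : (x : ℂ) ≠ 0 := by exact_mod_cast hx0.ne'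
  have hnorm : ∀ s : ℂ, 1 / 2 + ε ≤ s.re → s.re ≤ 3 / 2 →
      ‖(x : ℂ) ^ s * moebiusExpMellin s‖ ≤ x ^ s.re * (C * (1 + s.im ^ 2)⁻¹) := fun s h1 h2 ↦ by
    rw [norm_mul, Complex.norm_cpow_eq_rpow_re_of_pos hx0]
    gcongr
    exact hC s h1 h2
  have hshift := integral_vertical_eq_of_norm_le
    (f := fun s ↦ (x : ℂ) ^ s * moebiusExpMellin s) (a := 1 / 2 + ε) (b := 3 / 2)
    -- Since `x ≥ 1`, `x^(3/2)` dominates throughout the strip. This only justifies the shift; the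
    -- final estimate uses the left line.
    (C := x ^ (3 / 2 : ℝ) * C) (by linarith)
    (fun s hs ↦ ((differentiableAt_id.const_cpow (Or.inl hxc)).mul
      (h.differentiableAt_moebiusExpMellin (by linarith [hs.1])
        (by linarith [hs.2]))).differentiableWithinAt)
    (fun s h1 h2 ↦ (hnorm s h1 h2).trans (by
      rw [mul_assoc]
      gcongr))
  rw [h.moebiusExpSum_eq_integral hx0, ← hshift, norm_smul, Real.norm_of_nonneg (by positivity),
    mul_assoc]
  gcongr
  have hI : ∫ y : ℝ, x ^ (1 / 2 + ε) * (C * (1 + y ^ 2)⁻¹) = C * Real.pi * x ^ (1 / 2 + ε) := by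
    rw [integral_const_mul, integral_const_mul, integral_univ_inv_one_add_sq]; ring
  rw [← hI]
  refine norm_integral_le_of_norm_le ((integrable_inv_one_add_sq.const_mul C).const_mul _)
    (Eventually.of_forall fun y ↦ ?_)
  simpa using hnorm ((1 / 2 + ε : ℝ) + y * Complex.I) (by simp) (by simp; linarith)

lemma ZetaZeroFreeHalfPlane.fvbdHypothesis (h : ZetaZeroFreeHalfPlane) : FVBDHypothesis := by
  intro ε hε
  -- Capping `ε` at `1` keeps the new line at or to the left of `Re s = 3/2`.
  obtain ⟨C, hC0, hC⟩ := h.exists_norm_moebiusExpSum_le (ε := min ε 1) (by positivity)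
    (min_le_right _ _)
  obtain ⟨C₂, hC₂0, hC₂⟩ := exists_norm_invZetaDiff_sub_le
  -- The extra `1` makes the inequality strict.
  refine ⟨C + C₂ + 1, by positivity, fun n hn ↦ ?_⟩
  have hn' : (1 : ℝ) ≤ n := by exact_mod_cast hn
  have p1 : (n : ℝ) ^ (1 / 2 + min ε 1) ≤ (n : ℝ) ^ (1 / 2 + ε) :=
    Real.rpow_le_rpow_of_exponent_le hn' (by linarith [min_le_left ε 1])
  have p2 : (n : ℝ) ^ (1 / 2 : ℝ) ≤ (n : ℝ) ^ (1 / 2 + ε) :=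
    Real.rpow_le_rpow_of_exponent_le hn' (by linarith)
  have p3 : 0 < (n : ℝ) ^ (1 / 2 + ε) := by positivity
  have i1 := (hC n hn').trans (mul_le_mul_of_nonneg_left p1 hC0)
  have i2 := (hC₂ n hn).trans (mul_le_mul_of_nonneg_left p2 hC₂0)
  have i3 := norm_add_le (invZetaDiff n - moebiusExpSum n) (moebiusExpSum n)
  rw [sub_add_cancel] at i3
  linarith

theorem theorem3 : FVBDHypothesis ↔ ZetaZeroFreeHalfPlane :=
  ⟨FVBDHypothesis.zetaZeroFreeHalfPlane, ZetaZeroFreeHalfPlane.fvbdHypothesis⟩
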